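/- For $n\ge 1$ let $X_0,\dots,X_{n-1}$ be independent random variables with $\mathbb{P}[X_j=-1]=\mathbb{P}[X_j=1]=1/2$ for each $j$, and let $\mathcal{C}_n$ be the $n\times n$ circulant matrix with first row $X_0,\dots,X_{n-1}$, that is, the matrix whose $(i,j)$ entry is $X_{(j-i)\bmod n}$ for $0\le i,j\le n-1$. There are absolute constants $c_1,c_2,c_3>0$ such that the following hold. 1. If $n\ge 2$ is even, then $$\frac{c_1}{\sqrt n}\le \mathbb{P}[\mathcal{C}_n\text{ is singular}]\le \frac{c_2}{\sqrt n}.$$ 2. If $n\ge 3$ is odd, then $$\mathbb{P}[\mathcal{C}_n\text{ is singular}]\le \min\Bigl\{c_3\frac{d(n)}{n},\ \sum_{\substack{1<m\le n\\ m\mid n}}2^{-\varphi(m)}\Bigr\},$$ where $d(n)$ is the number of positive divisors of $n$ and $\varphi(m)$ is the number of positive integers less than $m$ which are relatively prime to $m$. 3. If $n\ge 3$ is prime, then $\mathbb{P}[\mathcal{C}_n\text{ is singular}]=2^{-n+1}$. -/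

import Mathlib

/-- The `n × n` circulant matrix with first row `x 0, …, x (n - 1)`: its `(i, j)` entry is
`x (j - i)`, with indices taken modulo `n`.  (Mathlib's `Matrix.circulant x` has first *column*
`x`, whence the transpose.) -/
def circulantOfRow {n : ℕ} (x : Fin n → ℂ) : Matrix (Fin n) (Fin n) ℂ :=
  (Matrix.circulant x).transpose

/-- The probability that the random circulant matrix with first row `X 0, …, X (n - 1)` is
singular, that is, not invertible. -/
noncomputable def singularityProb {n : ℕ} {Ω : Type*} [MeasurableSpace Ω]
    (μ : MeasureTheory.Measure Ω) (X : Fin n → Ω → ℂ) : ℝ :=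
  μ.real {ω | ¬ IsUnit (circulantOfRow (fun j => X j ω))}

/-- `X 0, …, X (n - 1)` are independent random variables, each of them equal to `1` with
probability `1 / 2` and to `-1` with probability `1 / 2`. -/
structure IsIIDSigns {n : ℕ} {Ω : Type*} [MeasurableSpace Ω]
    (μ : MeasureTheory.Measure Ω) (X : Fin n → Ω → ℂ) : Prop where
  measurable : ∀ j, Measurable (X j)
  indep : ProbabilityTheory.iIndepFun X μ
  prob_neg_one : ∀ j, μ.real {ω | X j ω = -1} = 1 / 2
  prob_one : ∀ j, μ.real {ω | X j ω = 1} = 1 / 2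

/-! The eigenvalues of the circulant matrix are the values f(z) = ∑ X_j z^j at the n-th roots of
unity z (`isUnit_circulantOfRow_iff`). As f has rational coefficients, its vanishing at z depends
only on the order m of z, so a union bound over the divisors m of n suffices
(`singularCount_le_sum`).

For z of order m put k = n/m. Grouping exponents modulo m gives f(z) = ∑_{r<m} S_r z^r, where the
S_r are independent sums of k signs. The powers z^r with r < φ(m) are independent over ℚ, so the
other S_r leave at most one value for each of these φ(m) sums. Hence f(z) = 0 has probability at
most ρ(k)^φ(m), where ρ(k) = C(k, ⌊k/2⌋)/2^k ≤ min(1/2, 1/√k).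

This is at most 2^(-φ(m)). For m ≥ 3 it is also at most 16/n, since φ(m) ≥ 2 and m ≤ 4·2^φ(m); for m
≤ 2 it is O(1/√n). With d(n) ≤ 2√n this gives the upper bounds. For odd n the term m = 1 vanishes by
parity. The lower bound for even n uses z = 1 alone, and for prime n only the two constant sign
vectors are singular. -/

namespace Nat

/-! ### Estimates for binomial coefficients, the totient and the divisor count -/

/-- The left side grows by a factor at most 16 at each step, because (2j + 1)(2j + 3) ≤ (2j + 2)².
-/
theorem centralBinom_sq_mul_le (j : ℕ) : centralBinom j ^ 2 * (2 * j + 1) ≤ 16 ^ j := by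
  induction j with
  | zero => simp
  | succ j ih =>
    have h := succ_mul_centralBinom_succ j
    have h2 : (j + 1) ^ 2 * (centralBinom (j + 1) ^ 2 * (2 * (j + 1) + 1)) ≤
        (j + 1) ^ 2 * 16 ^ (j + 1) := by
      calc (j + 1) ^ 2 * (centralBinom (j + 1) ^ 2 * (2 * (j + 1) + 1))
          = ((j + 1) * centralBinom (j + 1)) ^ 2 * (2 * j + 3) := by ring
        _ = 4 * ((2 * j + 1) * (2 * j + 3)) * (centralBinom j ^ 2 * (2 * j + 1)) := by
          rw [h]; ring
        _ ≤ 4 * (4 * (j + 1) ^ 2) * 16 ^ j :=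
          Nat.mul_le_mul (by nlinarith) ih
        _ = (j + 1) ^ 2 * 16 ^ (j + 1) := by ring
    exact le_of_mul_le_mul_left h2 (by positivity)

/-- The same induction with 4j(j + 1) ≤ (2j + 1)²; the index is shifted because the weight is zero
at 0. -/
theorem le_centralBinom_sq_mul (j : ℕ) : 
    16 ^ (j + 1) ≤ centralBinom (j + 1) ^ 2 * (4 * (j + 1)) := by
  induction j with
  | zero => simp [centralBinom, choose]
  | succ j ih =>
    have h := succ_mul_centralBinom_succ (j + 1)
    have h2 : (j + 2) ^ 2 * 16 ^ (j + 2) ≤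
        (j + 2) ^ 2 * (centralBinom (j + 2) ^ 2 * (4 * (j + 2))) := by
      calc (j + 2) ^ 2 * 16 ^ (j + 2) = 16 * (j + 2) ^ 2 * 16 ^ (j + 1) := by ring
        _ ≤ 16 * (j + 2) ^ 2 * (centralBinom (j + 1) ^ 2 * (4 * (j + 1))) := by gcongr
        _ = 16 * (j + 2) * centralBinom (j + 1) ^ 2 * (4 * (j + 1) * (j + 2)) := by ring
        _ ≤ 16 * (j + 2) * centralBinom (j + 1) ^ 2 * (2 * (j + 1) + 1) ^ 2 := by
          gcongr
          nlinarith
        _ = ((2 * (2 * (j + 1) + 1)) * centralBinom (j + 1)) ^ 2 * (4 * (j + 2)) := by ring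
        _ = (j + 2) ^ 2 * (centralBinom (j + 2) ^ 2 * (4 * (j + 2))) := by
          rw [← h]; ring
    exact le_of_mul_le_mul_left h2 (by positivity)

theorem choose_half_sq_mul_le (k : ℕ) : choose k (k / 2) ^ 2 * k ≤ 4 ^ k := by
  obtain ⟨j, rfl | rfl⟩ := Nat.even_or_odd' k
  · have h := centralBinom_sq_mul_le j
    rw [centralBinom] at h
    rw [Nat.mul_div_cancel_left _ (by norm_num), pow_mul]
    norm_num
    nlinarith
  · have h := centralBinom_sq_mul_le (j + 1)
    have h1 : centralBinom (j + 1) = 2 * choose (2 * j + 1) j := by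
      rw [centralBinom, show 2 * (j + 1) = (2 * j + 1) + 1 by ring, choose_succ_succ,
        ← choose_symm_half j]
      ring
    rw [h1] at h
    rw [show (2 * j + 1) / 2 = j by omega, pow_succ 4, pow_mul]
    norm_num
    rw [pow_succ 16] at h
    nlinarith

theorem le_two_mul_totient_sq (m : ℕ) : m ≤ 2 * totient m ^ 2 := by
  -- The factor 2 is lost only at the prime 2. Proving m ≤ φ(m)² for odd m makes the bound
  -- multiplicative, since of two coprime factors at most one is even.
  have key : ∀ m : ℕ, 0 < m → (if Even m then m else 2 * m) ≤ 2 * totient m ^ 2 := by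
    intro m
    induction m using Nat.recOnPosPrimePosCoprime with
    | prime_pow p n hp hn =>
      intro _
      obtain ⟨n, rfl⟩ := Nat.exists_eq_succ_of_ne_zero hn.ne'
      rw [totient_prime_pow_succ hp]
      have h1 : 1 ≤ p ^ n := Nat.one_le_pow _ _ hp.pos
      rcases hp.eq_two_or_odd' with rfl | ho
      · rw [if_pos (by simp [parity_simps])]
        simp [pow_succ]
        nlinarith
      · rw [if_neg (by simp [parity_simps, Nat.not_even_iff_odd.2 ho])]
        obtain ⟨q, rfl⟩ := ho
        have hq : 1 ≤ q := by have := hp.two_le; omega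
        simp only [Nat.add_sub_cancel, pow_succ _ n, Nat.succ_eq_add_one]
        generalize (2 * q + 1) ^ n = a at *
        nlinarith [mul_le_mul h1 hq zero_le_one (zero_le _), mul_le_mul h1 h1 zero_le_one (zero_le _), Nat.mul_le_mul h1 (Nat.mul_le_mul hq hq), Nat.mul_le_mul_right (a * (2*q)^2) h1, Nat.mul_le_mul_left (4*a*q) hq, Nat.mul_le_mul_left a hq]
    | zero => simp
    | one => simp
    | coprime a b ha hb hab iha ihb =>
      intro _
      have iha := iha (by omega)
      have ihb := ihb (by omega)
      rw [totient_mul hab, mul_pow]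
      have : ¬ (Even a ∧ Even b) := by
        rintro ⟨h1, h2⟩
        have := Nat.dvd_gcd h1.two_dvd h2.two_dvd
        rw [hab] at this
        omega
      by_cases h1 : Even a <;> by_cases h2 : Even b <;> simp only [h1, h2, if_true, if_false, Nat.even_mul, true_or, or_true, or_self] at iha ihb ⊢
      · exact absurd ⟨h1, h2⟩ this
      · nlinarith [Nat.mul_le_mul iha ihb]
      · nlinarith [Nat.mul_le_mul iha ihb]
      · nlinarith [Nat.mul_le_mul iha ihb]
  rcases m.eq_zero_or_pos with rfl | h
  · simp
  · have := key m h
    split_ifs at this <;> omega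

theorem sq_le_two_mul_two_pow (a : ℕ) : a ^ 2 ≤ 2 * 2 ^ a := by
  -- The induction starts at 3 because (a + 1)² ≤ 2a² fails for a = 1 and a = 2.
  have h : ∀ b : ℕ, (b + 3) ^ 2 ≤ 2 * 2 ^ (b + 3) := by
    intro b
    induction b with
    | zero => norm_num
    | succ b ih =>
      rw [show b + 1 + 3 = (b + 3) + 1 by ring, pow_succ 2]
      nlinarith [zero_le (b * b), zero_le b]
  rcases a with _ | _ | _ | b
  · simp
  · simp
  · simp
  · exact h b

theorem le_mul_two_pow_totient (m : ℕ) : m ≤ 4 * 2 ^ totient m := by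
  linarith [le_two_mul_totient_sq m, sq_le_two_mul_two_pow (totient m)]

/-- In each factorisation n = d * e one of the factors is at most √n. -/
theorem card_divisors_le_two_mul_sqrt (n : ℕ) : n.divisors.card ≤ 2 * sqrt n := by
  have h : n.divisors ⊆ Finset.Ioc 0 (sqrt n) ∪ (Finset.Ioc 0 (sqrt n)).image (n / ·) := by
    intro d hd
    have hd0 := Nat.pos_of_mem_divisors hd
    obtain ⟨⟨e, he⟩, hn⟩ := Nat.mem_divisors.1 hd
    have he0 : 0 < e := Nat.pos_of_ne_zero (by rintro rfl; simp at he; exact hn he)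
    simp only [Finset.mem_union, Finset.mem_Ioc, Finset.mem_image]
    by_contra! hc
    have h1 := hc.1 hd0
    have h2 : e ≤ sqrt n → False := fun h =>
      hc.2 e ⟨he0, h⟩ (by rw [he, Nat.mul_div_cancel _ he0])
    have h3 : sqrt n + 1 ≤ e := by by_contra hh; exact h2 (by omega)
    have := Nat.lt_succ_sqrt n
    have := Nat.mul_le_mul h1 h3
    simp only [Nat.succ_eq_add_one] at *
    omega
  calc n.divisors.card
      ≤ (Finset.Ioc 0 (sqrt n) ∪ (Finset.Ioc 0 (sqrt n)).image (n / ·)).card :=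
        Finset.card_le_card h
    _ ≤ (Finset.Ioc 0 (sqrt n)).card + ((Finset.Ioc 0 (sqrt n)).image (n / ·)).card :=
      Finset.card_union_le _ _
    _ ≤ (Finset.Ioc 0 (sqrt n)).card + (Finset.Ioc 0 (sqrt n)).card := by
      exact Nat.add_le_add_left Finset.card_image_le _
    _ = 2 * sqrt n := by simp; ring

end Nat

/-! ### Anticoncentration of linear forms and of sums of signs -/

/-- If every value of `Y : B → ℤ` is taken at most `q` times, and the `v r` with `r ∈ s` are
linearly independent over `ℚ`, then `∑ r, Y (b r) * v r` vanishes for few families `b`. -/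
theorem card_filter_sum_mul_eq_zero_le {ι B : Type*} [Fintype ι] [DecidableEq ι] [Fintype B]
    [DecidableEq B] (s : Finset ι) (v : ι → ℂ) (hv : LinearIndependent ℚ (fun r : s => v r))
    (Y : B → ℤ) (q : ℕ) (hq : ∀ y, (Finset.univ.filter fun b => Y b = y).card ≤ q) :
    (Finset.univ.filter fun b : ι → B => ∑ r, (Y (b r) : ℂ) * v r = 0).card ≤
      q ^ s.card * Fintype.card B ^ (Fintype.card ι - s.card) := by
  -- Fibre the solutions over their coordinates outside `s`. Two solutions in one fibre differ by a
  -- rational relation among the independent `v r`, so they agree in every `Y (b r)`, which leaves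
  -- at most `q` choices for each `r ∈ s`.
  have h1 := Finset.card_le_mul_card_image
    (f := fun (b : ι → B) (r : (sᶜ : Finset ι)) => b r)
    (Finset.univ.filter fun b : ι → B => ∑ r, (Y (b r) : ℂ) * v r = 0) (q ^ s.card) ?_
  · refine h1.trans (Nat.mul_le_mul_left _ ((Finset.card_le_univ _).trans_eq ?_))
    simp
  · intro c hc
    obtain ⟨b₀, hb₀, rfl⟩ := Finset.mem_image.1 hc
    have hb₀ := (Finset.mem_filter.1 hb₀).2
    have hsub : ((Finset.univ.filter fun b : ι → B => ∑ r, (Y (b r) : ℂ) * v r = 0).filter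
        fun b => (fun r : (sᶜ : Finset ι) => b r) = fun r : (sᶜ : Finset ι) => b₀ r) ⊆
        Fintype.piFinset fun r =>
          if r ∈ s then Finset.univ.filter (fun b => Y b = Y (b₀ r)) else {b₀ r} := by
      intro b hb
      simp only [Finset.mem_filter, Finset.mem_univ, true_and, funext_iff, Subtype.forall,
        Finset.mem_compl] at hb
      obtain ⟨hb, hbc⟩ := hb
      have hdiff : ∑ r : s, ((Y (b r) - Y (b₀ r) : ℤ) : ℚ) • v r = 0 := by
        rw [Finset.sum_coe_sort s (fun r => ((Y (b r) - Y (b₀ r) : ℤ) : ℚ) • v r)]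
        calc ∑ r ∈ s, ((Y (b r) - Y (b₀ r) : ℤ) : ℚ) • v r
            = ∑ r, ((Y (b r) - Y (b₀ r) : ℤ) : ℚ) • v r := by
              refine Finset.sum_subset (Finset.subset_univ _) fun r _ hr => ?_
              simp [hbc r hr]
          _ = ∑ r, (Y (b r) : ℂ) * v r - ∑ r, (Y (b₀ r) : ℂ) * v r := by
              rw [← Finset.sum_sub_distrib]
              refine Finset.sum_congr rfl fun r _ => ?_
              rw [Algebra.smul_def]
              simp [sub_mul]
          _ = 0 := by rw [hb, hb₀, sub_zero]
      rw [Fintype.mem_piFinset]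
      intro r
      split_ifs with hr
      · have := Fintype.linearIndependent_iff.1 hv _ hdiff ⟨r, hr⟩
        simp only [Int.cast_eq_zero, sub_eq_zero] at this
        simpa using this
      · simpa using hbc r hr
    refine (Finset.card_le_card hsub).trans ?_
    rw [Fintype.card_piFinset]
    calc ∏ r, (if r ∈ s then Finset.univ.filter (fun b => Y b = Y (b₀ r)) else {b₀ r}).card
        ≤ ∏ r, (if r ∈ s then q else 1) := by
          refine Finset.prod_le_prod' fun r _ => ?_
          split_ifs
          · exact hq _
          · simp
      _ = q ^ s.card := by simp [Finset.prod_ite_mem]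

theorem Int.units_sum_eq {ι : Type*} [Fintype ι] (ε : ι → ℤˣ) :
    ∑ i, (ε i : ℤ) = 2 * (Finset.univ.filter fun i => ε i = 1).card - Fintype.card ι := by
  have h : ∀ i, (ε i : ℤ) = 2 * (if ε i = 1 then 1 else 0) - 1 := fun i => by
    rcases Int.units_eq_one_or (ε i) with h | h <;> simp [h]
  rw [Finset.sum_congr rfl fun i _ => h i, Finset.sum_sub_distrib, ← Finset.mul_sum]
  simp

theorem Int.units_fun_ext {ι : Type*} {ε ε' : ι → ℤˣ} (h : ∀ i, ε i = 1 ↔ ε' i = 1) : ε = ε' := by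
  funext i
  have := h i
  rcases Int.units_eq_one_or (ε i) with h | h <;> rcases Int.units_eq_one_or (ε' i) with h' | h' <;>
    simp_all

theorem card_filter_sum_units_eq_le {ι : Type*} [Fintype ι] [DecidableEq ι] (y : ℤ) :
    (Finset.univ.filter fun ε : ι → ℤˣ => ∑ i, (ε i : ℤ) = y).card ≤
      (Fintype.card ι).choose (Fintype.card ι / 2) := by
  -- A sum equal to `y` forces (y + card)/2 plus signs. If that is not a natural number, no sign
  -- vector has sum `y` and the rounding is harmless.
  refine le_trans ?_ (Nat.choose_le_middle ((y + Fintype.card ι) / 2).toNat (Fintype.card ι))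
  rw [← Finset.card_univ (α := ι), ← Finset.card_powersetCard]
  refine Finset.card_le_card_of_injOn (fun ε => Finset.univ.filter fun i => ε i = 1) ?_ ?_
  · intro ε hε
    have h1 : ∑ i, (ε i : ℤ) = y := by simpa using hε
    rw [Int.units_sum_eq] at h1
    simp only [Finset.mem_coe, Finset.mem_powersetCard, Finset.subset_univ, true_and,
      Finset.card_univ]
    omega
  · intro ε _ ε' _ h
    refine Int.units_fun_ext fun i => ?_
    have := Finset.ext_iff.1 h i
    simpa using this

theorem choose_half_le_card_filter_sum_units_eq_zero {ι : Type*} [Fintype ι]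
    [DecidableEq ι] (h : Even (Fintype.card ι)) :
    (Fintype.card ι).choose (Fintype.card ι / 2) ≤
      (Finset.univ.filter fun ε : ι → ℤˣ => ∑ i, (ε i : ℤ) = 0).card := by
  conv_lhs => rw [← Finset.card_univ (α := ι), ← Finset.card_powersetCard]
  have key : ∀ s : Finset ι,
      (Finset.univ.filter fun i => (if i ∈ s then (1 : ℤˣ) else -1) = 1) = s := by
    intro s
    ext i
    by_cases hi : i ∈ s <;> simp [hi]
  refine Finset.card_le_card_of_injOn (fun s i => if i ∈ s then 1 else -1) ?_ ?_
  · intro s hs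
    have hs : s.card = Fintype.card ι / 2 := by simpa using hs
    simp only [Finset.coe_filter, Finset.mem_univ, true_and, Set.mem_ofPred_eq]
    rw [Int.units_sum_eq, key, hs]
    obtain ⟨k, hk⟩ := h
    omega
  · intro s _ t _ hst
    rw [← key s, ← key t]
    exact congrArg (fun ε : ι → ℤˣ => Finset.univ.filter fun i => ε i = 1) hst

/-! ### Spectrum of a circulant matrix -/

/-- The polynomial with coefficients `x`, evaluated at `z`. -/
noncomputable def rowEval {n : ℕ} (x : Fin n → ℂ) (z : ℂ) : ℂ :=
  ∑ j, x j * z ^ (j : ℕ)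

theorem Fin.pow_val_add {M : Type*} [Monoid M] {n : ℕ} {z : M} (hz : z ^ n = 1) (i j : Fin n) :
    z ^ ((i + j : Fin n) : ℕ) = z ^ (i : ℕ) * z ^ (j : ℕ) := by
  rw [Fin.val_add, ← pow_eq_pow_mod _ hz, pow_add]

/-- The vector (w^j)_j is an eigenvector: substituting j + i for j in ∑ x_{j-i} w^j pulls out w^i,
and w^n = 1 takes care of the wraparound. -/
theorem circulantOfRow_mul_vandermonde_transpose {n : ℕ} (x w : Fin n → ℂ)
    (hw : ∀ k, w k ^ n = 1) :
    circulantOfRow x * (Matrix.vandermonde w).transpose =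
      (Matrix.vandermonde w).transpose * Matrix.diagonal fun k => rowEval x (w k) := by
  rcases Nat.eq_zero_or_pos n with rfl | hn
  · ext i; exact i.elim0
  have : NeZero n := ⟨hn.ne'⟩
  ext i k
  rw [Matrix.mul_diagonal, Matrix.mul_apply]
  simp only [circulantOfRow, Matrix.transpose_apply, Matrix.circulant_apply,
    Matrix.vandermonde_apply, rowEval]
  rw [Finset.mul_sum, ← Equiv.sum_comp (Equiv.addRight i)]
  refine Finset.sum_congr rfl fun j _ => ?_
  simp only [Equiv.coe_addRight, add_sub_cancel_right]
  rw [Fin.pow_val_add (hw k)]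
  ring

theorem isUnit_circulantOfRow_iff {n : ℕ} (hn : n ≠ 0) (x : Fin n → ℂ) :
    IsUnit (circulantOfRow x) ↔ ∀ z : ℂ, z ^ n = 1 → rowEval x z ≠ 0 := by
  have hζ := Complex.isPrimitiveRoot_exp n hn
  have : NeZero n := ⟨hn⟩
  set ζ := Complex.exp (2 * Real.pi * Complex.I / n)
  set w : Fin n → ℂ := fun k => ζ ^ (k : ℕ) with hw
  have hw1 : ∀ k, w k ^ n = 1 := fun k => by
    rw [hw, ← pow_mul, mul_comm, pow_mul, hζ.pow_eq_one, one_pow]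
  have hV : (Matrix.vandermonde w).det ≠ 0 := by
    rw [Matrix.det_vandermonde_ne_zero_iff]
    intro a b hab
    exact Fin.ext (hζ.pow_inj a.2 b.2 hab)
  have hdet := congrArg Matrix.det (circulantOfRow_mul_vandermonde_transpose x w hw1)
  rw [Matrix.det_mul, Matrix.det_mul, Matrix.det_transpose, Matrix.det_diagonal, mul_comm] at hdet
  rw [Matrix.isUnit_iff_isUnit_det, mul_left_cancel₀ hV hdet, isUnit_iff_ne_zero,
    Finset.prod_ne_zero_iff]
  constructor
  · intro h z hz
    obtain ⟨k, hk, rfl⟩ := hζ.eq_pow_of_pow_eq_one hz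
    exact h ⟨k, hk⟩ (Finset.mem_univ _)
  · exact fun h k _ => h _ (hw1 k)

/-! ### Counting sign vectors that vanish at a root of unity -/

/-- The number of sign vectors `ε` for which `∑ j, ε j * z ^ j` vanishes. -/
noncomputable def vanishingCount (n : ℕ) (z : ℂ) : ℕ :=
  (Finset.univ.filter fun ε : Fin n → ℤˣ => rowEval (fun j => ((ε j : ℤ) : ℂ)) z = 0).card

open scoped Classical in
/-- The number of sign vectors with a singular circulant matrix. -/
noncomputable def singularCount (n : ℕ) : ℕ :=
  (Finset.univ.filter fun ε : Fin n → ℤˣ =>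
    ¬ IsUnit (circulantOfRow fun j => ((ε j : ℤ) : ℂ))).card

/-- Grouping the terms of `∑ j, ε j * z ^ j` by the residue of `j` modulo the order of `z`. -/
theorem rowEval_mul {m k : ℕ} {z : ℂ} (hz : z ^ m = 1) (x : Fin (k * m) → ℂ) :
    rowEval x z = ∑ r : Fin m, (∑ a : Fin k, x (finProdFinEquiv (a, r))) * z ^ (r : ℕ) := by
  rw [rowEval, ← Equiv.sum_comp finProdFinEquiv, Fintype.sum_prod_type_right]
  refine Finset.sum_congr rfl fun r _ => ?_
  rw [Finset.sum_mul]
  refine Finset.sum_congr rfl fun a _ => ?_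
  rw [show ((finProdFinEquiv (a, r) : Fin (k * m)) : ℕ) = r + m * a from rfl, pow_add, pow_mul, hz,
    one_pow, mul_one]

/-- The minimal polynomial of `z` over ℚ is the `m`-th cyclotomic polynomial, of degree φ(m). -/
theorem IsPrimitiveRoot.linearIndependent_pow_lt_totient {m : ℕ} (hm : 0 < m) {z : ℂ}
    (hz : IsPrimitiveRoot z m) :
    LinearIndependent ℚ
      (fun r : (Finset.univ.filter fun r : Fin m => (r : ℕ) < m.totient) =>
        z ^ ((r : Fin m) : ℕ)) := by
  have h := linearIndependent_pow (K := ℚ) z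
  have hd : (minpoly ℚ z).natDegree = m.totient := by
    rw [← Polynomial.cyclotomic_eq_minpoly_rat hz hm, Polynomial.natDegree_cyclotomic]
  have hlt : ∀ r : (Finset.univ.filter fun r : Fin m => (r : ℕ) < m.totient),
      ((r : Fin m) : ℕ) < (minpoly ℚ z).natDegree := fun r => by
    rw [hd]; exact (Finset.mem_filter.1 r.2).2
  exact h.comp (fun r : (Finset.univ.filter fun r : Fin m => (r : ℕ) < m.totient) =>
    (⟨((r : Fin m) : ℕ), hlt r⟩ : Fin (minpoly ℚ z).natDegree)) fun r s hrs =>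
    Subtype.ext (Fin.ext (Fin.mk.inj hrs))

theorem vanishingCount_mul_le {m k : ℕ} (hm : 0 < m) {z : ℂ} (hz : IsPrimitiveRoot z m) :
    vanishingCount (k * m) z ≤
      k.choose (k / 2) ^ m.totient * (2 ^ k) ^ (m - m.totient) := by
  classical
  have hcard : (Finset.univ.filter fun r : Fin m => (r : ℕ) < m.totient).card = m.totient := by
    rw [Fin.card_filter_val_lt, min_eq_right (Nat.totient_le m)]
  -- Each residue class modulo `m` carries a block of `k` signs, which enters only through its sum.
  have h := card_filter_sum_mul_eq_zero_le (B := Fin k → ℤˣ)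
    (Finset.univ.filter fun r : Fin m => (r : ℕ) < m.totient) (fun r => z ^ (r : ℕ))
    (hz.linearIndependent_pow_lt_totient hm) (fun ε => ∑ a, (ε a : ℤ)) (k.choose (k / 2))
    (fun y => by simpa using card_filter_sum_units_eq_le (ι := Fin k) y)
  rw [hcard] at h
  refine le_trans ?_ (h.trans_eq ?_)
  · refine Finset.card_le_card_of_injOn (fun ε r a => ε (finProdFinEquiv (a, r))) ?_ ?_
    · intro ε hε
      have hε : rowEval (fun j => ((ε j : ℤ) : ℂ)) z = 0 := by simpa using hε
      rw [rowEval_mul hz.pow_eq_one] at hε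
      simpa using hε
    · intro ε _ ε' _ hεε'
      funext j
      obtain ⟨⟨a, r⟩, rfl⟩ := finProdFinEquiv.surjective j
      exact congrFun (congrFun hεε' r) a
  · simp

/-- Primitive `m`-th roots are conjugate over ℚ, so one test root per divisor of `n` is enough. -/
theorem rowEval_eq_zero_of_isPrimitiveRoot {n m : ℕ} (hm : 0 < m) {z w : ℂ}
    (hz : IsPrimitiveRoot z m) (hw : IsPrimitiveRoot w m) (ε : Fin n → ℤˣ)
    (h : rowEval (fun j => ((ε j : ℤ) : ℂ)) z = 0) :
    rowEval (fun j => ((ε j : ℤ) : ℂ)) w = 0 := by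
  set p : Polynomial ℚ := ∑ j, Polynomial.C ((ε j : ℤ) : ℚ) * Polynomial.X ^ (j : ℕ) with hp
  have hev : ∀ u : ℂ, Polynomial.aeval u p = rowEval (fun j => ((ε j : ℤ) : ℂ)) u := fun u => by
    simp [hp, rowEval]
  rw [← hev] at h ⊢
  have hdvd := minpoly.dvd ℚ z h
  rw [← Polynomial.cyclotomic_eq_minpoly_rat hz hm,
    Polynomial.cyclotomic_eq_minpoly_rat hw hm] at hdvd
  exact Polynomial.aeval_eq_zero_of_dvd_aeval_eq_zero hdvd (minpoly.aeval ℚ w)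

/-- A primitive `m`-th root of unity, for `m ≠ 0`. -/
noncomputable def unityRoot (m : ℕ) : ℂ := Complex.exp (2 * Real.pi * Complex.I / m)

theorem isPrimitiveRoot_unityRoot {m : ℕ} (hm : m ≠ 0) : IsPrimitiveRoot (unityRoot m) m :=
  Complex.isPrimitiveRoot_exp m hm

theorem not_isUnit_circulantOfRow_units_iff {n : ℕ} (hn : n ≠ 0) (ε : Fin n → ℤˣ) :
    ¬ IsUnit (circulantOfRow fun j => ((ε j : ℤ) : ℂ)) ↔
      ∃ m ∈ n.divisors, rowEval (fun j => ((ε j : ℤ) : ℂ)) (unityRoot m) = 0 := by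
  rw [isUnit_circulantOfRow_iff hn]
  push Not
  constructor
  · rintro ⟨z, hz, h⟩
    have hd : orderOf z ∣ n := orderOf_dvd_of_pow_eq_one hz
    have hpos := Nat.pos_of_dvd_of_pos hd (Nat.pos_of_ne_zero hn)
    exact ⟨orderOf z, Nat.mem_divisors.2 ⟨hd, hn⟩, rowEval_eq_zero_of_isPrimitiveRoot hpos
      (IsPrimitiveRoot.orderOf z) (isPrimitiveRoot_unityRoot hpos.ne') ε h⟩
  · rintro ⟨m, hm, h⟩
    have hm0 := (Nat.pos_of_mem_divisors hm).ne'
    obtain ⟨d, rfl⟩ := Nat.dvd_of_mem_divisors hm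
    exact ⟨unityRoot m, by rw [pow_mul, (isPrimitiveRoot_unityRoot hm0).pow_eq_one, one_pow], h⟩

theorem singularCount_le_sum {n : ℕ} (hn : n ≠ 0) :
    singularCount n ≤ ∑ m ∈ n.divisors, vanishingCount n (unityRoot m) := by
  classical
  refine le_trans (Finset.card_le_card fun ε hε => ?_) Finset.card_biUnion_le
  have := (Finset.mem_filter.1 hε).2
  rw [not_isUnit_circulantOfRow_units_iff hn] at this
  simpa using this

theorem unityRoot_one : unityRoot 1 = 1 :=
  IsPrimitiveRoot.one_right_iff.1 (isPrimitiveRoot_unityRoot one_ne_zero)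

theorem rowEval_units_one {n : ℕ} (ε : Fin n → ℤˣ) :
    rowEval (fun j => ((ε j : ℤ) : ℂ)) 1 = ((∑ j, (ε j : ℤ) : ℤ) : ℂ) := by
  simp [rowEval]

theorem choose_half_le_singularCount {n : ℕ} (hn : n ≠ 0) (he : Even n) :
    n.choose (n / 2) ≤ singularCount n := by
  have h := choose_half_le_card_filter_sum_units_eq_zero (ι := Fin n) (by simpa using he)
  simp only [Fintype.card_fin] at h
  refine h.trans (Finset.card_le_card fun ε hε => ?_)
  simp only [Finset.mem_filter, Finset.mem_univ, true_and] at hε ⊢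
  rw [not_isUnit_circulantOfRow_units_iff hn]
  exact ⟨1, by simp [hn], by rw [unityRoot_one, rowEval_units_one, hε, Int.cast_zero]⟩

theorem rowEval_units_one_ne_zero {n : ℕ} (ho : Odd n) (ε : Fin n → ℤˣ) :
    rowEval (fun j => ((ε j : ℤ) : ℂ)) 1 ≠ 0 := by
  rw [rowEval_units_one, Int.cast_ne_zero, Int.units_sum_eq, Fintype.card_fin]
  obtain ⟨k, rfl⟩ := ho
  omega

theorem vanishingCount_one_of_odd {n : ℕ} (ho : Odd n) : vanishingCount n (unityRoot 1) = 0 := by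
  rw [vanishingCount, Finset.card_eq_zero, Finset.filter_eq_empty_iff]
  intro ε _
  rw [unityRoot_one]
  exact rowEval_units_one_ne_zero ho ε

/-- Subtracting ε_{p-1} ∑ z^j = 0 removes the last term and leaves a relation among the powers below
p - 1 = φ(p), which are independent. So every sign equals the last one. -/
theorem rowEval_units_unityRoot_prime_iff {p : ℕ} (hp : p.Prime) (ε : Fin p → ℤˣ) :
    rowEval (fun j => ((ε j : ℤ) : ℂ)) (unityRoot p) = 0 ↔ ∃ u : ℤˣ, ε = fun _ => u := by
  have hz := isPrimitiveRoot_unityRoot hp.ne_zero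
  have hgeom : ∑ j : Fin p, unityRoot p ^ (j : ℕ) = 0 := by
    rw [Fin.sum_univ_eq_sum_range (fun j => unityRoot p ^ j)]
    exact hz.geom_sum_eq_zero hp.one_lt
  constructor
  · intro h
    have hlast : p - 1 < p := Nat.sub_lt hp.pos one_pos
    refine ⟨ε ⟨p - 1, hlast⟩, ?_⟩
    have hind := Fintype.linearIndependent_iff.1 (hz.linearIndependent_pow_lt_totient hp.pos)
      (fun r => (((ε r : ℤ) - (ε ⟨p - 1, hlast⟩ : ℤ) : ℤ) : ℚ)) ?_
    · funext j
      by_cases hj : (j : ℕ) < p.totient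
      · have := hind ⟨j, by simpa using hj⟩
        rw [Int.cast_eq_zero, sub_eq_zero] at this
        exact Units.ext this
      · rw [Nat.totient_prime hp] at hj
        congr 1
        exact Fin.ext (by have := j.2; simp only; omega)
    · rw [Finset.sum_coe_sort (Finset.univ.filter fun r : Fin p => (r : ℕ) < p.totient)
        (fun r => (((ε r : ℤ) - (ε ⟨p - 1, hlast⟩ : ℤ) : ℤ) : ℚ) • unityRoot p ^ (r : ℕ))]
      rw [Finset.sum_subset (Finset.subset_univ _)]
      · calc ∑ r, (((ε r : ℤ) - (ε ⟨p - 1, hlast⟩ : ℤ) : ℤ) : ℚ) • unityRoot p ^ (r : ℕ)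
            = rowEval (fun j => ((ε j : ℤ) : ℂ)) (unityRoot p)
              - ((ε ⟨p - 1, hlast⟩ : ℤ) : ℂ) * ∑ j : Fin p, unityRoot p ^ (j : ℕ) := by
              rw [rowEval, Finset.mul_sum, ← Finset.sum_sub_distrib]
              refine Finset.sum_congr rfl fun r _ => ?_
              rw [Algebra.smul_def]
              simp [sub_mul]
          _ = 0 := by rw [h, hgeom, mul_zero, sub_zero]
      · intro r _ hr
        have : r = ⟨p - 1, hlast⟩ := by
          rw [Nat.totient_prime hp] at hr
          have := r.2
          simp only [Finset.mem_filter, Finset.mem_univ, true_and] at hr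
          exact Fin.ext (by simp only; omega)
        simp [this]
  · rintro ⟨u, rfl⟩
    simp only [rowEval]
    rw [← Finset.mul_sum, hgeom, mul_zero]

open scoped Classical in
theorem singularCount_prime {p : ℕ} (hp : p.Prime) (h3 : 3 ≤ p) : singularCount p = 2 := by
  have ho : Odd p := hp.odd_of_ne_two (by omega)
  have : NeZero p := ⟨hp.ne_zero⟩
  have : (Finset.univ.filter fun ε : Fin p → ℤˣ =>
      ¬ IsUnit (circulantOfRow fun j => ((ε j : ℤ) : ℂ))) =
      Finset.univ.image fun (u : ℤˣ) (_ : Fin p) => u := by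
    ext ε
    simp only [Finset.mem_filter, Finset.mem_univ, true_and, Finset.mem_image]
    rw [not_isUnit_circulantOfRow_units_iff hp.ne_zero, hp.divisors]
    simp only [Finset.mem_insert, Finset.mem_singleton, exists_eq_or_imp, exists_eq_left,
      unityRoot_one, rowEval_units_one_ne_zero ho, false_or, rowEval_units_unityRoot_prime_iff hp]
    exact exists_congr fun u => eq_comm
  rw [singularCount, this, Finset.card_image_of_injective]
  · rfl
  · exact fun u v huv => congrFun huv 0

/-! ### From probability to counting -/

open MeasureTheory in
theorem IsIIDSigns.singularityProb_eq {n : ℕ} {Ω : Type*} [MeasurableSpace Ω] {μ : Measure Ω}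
    [IsProbabilityMeasure μ] {X : Fin n → Ω → ℂ} (h : IsIIDSigns μ X) :
    singularityProb μ X = singularCount n / 2 ^ n := by
  classical
  set E : (Fin n → ℤˣ) → Set Ω := fun ε => ⋂ j, X j ⁻¹' {((ε j : ℤ) : ℂ)} with hE
  have hEm : ∀ ε, MeasurableSet (E ε) := fun ε =>
    MeasurableSet.iInter fun j => h.measurable j (measurableSet_singleton _)
  have hEμ : ∀ ε, μ.real (E ε) = (1 / 2) ^ n := by
    intro ε
    rw [measureReal_def, hE, h.indep.meas_iInter fun j => ⟨_, measurableSet_singleton _, rfl⟩,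
      ENNReal.toReal_prod]
    have : ∀ j, (μ (X j ⁻¹' {((ε j : ℤ) : ℂ)})).toReal = 1 / 2 := by
      intro j
      rcases Int.units_eq_one_or (ε j) with hj | hj
      · rw [hj, ← h.prob_one j]; simp [measureReal_def, Set.preimage]
      · rw [hj, ← h.prob_neg_one j]; simp [measureReal_def, Set.preimage]
    simp [this]
  have hmem : ∀ {ε ω}, ω ∈ E ε ↔ (fun j => X j ω) = fun j => ((ε j : ℤ) : ℂ) := by
    intro ε ω
    simp [hE, funext_iff]
  have hdisj : ∀ s : Set (Fin n → ℤˣ), s.PairwiseDisjoint E := by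
    intro s ε _ ε' _ hne
    refine Set.disjoint_left.2 fun ω h1 h2 => hne ?_
    have := (hmem.1 h1).symm.trans (hmem.1 h2)
    funext j
    exact Units.ext (by exact_mod_cast congrFun this j)
  have hU : ∀ s : Finset (Fin n → ℤˣ), μ.real (⋃ ε ∈ s, E ε) = s.card * (1 / 2) ^ n := by
    intro s
    rw [measureReal_biUnion_finset (hdisj _) fun ε _ => hEm ε, Finset.sum_congr rfl fun ε _ => hEμ ε]
    simp
  -- The 2^n disjoint events `E ε` have probability 2^(-n) each, so they exhaust the space almost
  -- surely.
  have hae : ∀ᵐ ω ∂μ, ∃ ε, ω ∈ E ε := by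
    have h1 : μ.real (⋃ ε ∈ (Finset.univ : Finset (Fin n → ℤˣ)), E ε) = 1 := by
      rw [hU]
      simp
    have hm : MeasurableSet (⋃ ε ∈ (Finset.univ : Finset (Fin n → ℤˣ)), E ε) :=
      Finset.measurableSet_biUnion _ fun ε _ => hEm ε
    have h2 : μ (⋃ ε ∈ (Finset.univ : Finset (Fin n → ℤˣ)), E ε) = 1 := by
      rwa [measureReal_def, ENNReal.toReal_eq_one_iff] at h1
    have h3 := (mem_ae_iff_prob_eq_one hm).2 h2
    filter_upwards [h3] with ω hω
    simpa using hω
  have hcongr : μ.real {ω | ¬ IsUnit (circulantOfRow fun j => X j ω)} =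
      μ.real (⋃ ε ∈ Finset.univ.filter fun ε : Fin n → ℤˣ =>
        ¬ IsUnit (circulantOfRow fun j => ((ε j : ℤ) : ℂ)), E ε) := by
    refine measureReal_congr ?_
    filter_upwards [hae] with ω hω
    obtain ⟨ε, hε⟩ := hω
    refine propext ?_
    change ¬ IsUnit (circulantOfRow fun j => X j ω) ↔ ω ∈ (⋃ ε ∈ Finset.univ.filter
      fun ε : Fin n → ℤˣ => ¬ IsUnit (circulantOfRow fun j => ((ε j : ℤ) : ℂ)), E ε)
    simp only [Set.mem_iUnion, Finset.mem_filter, Finset.mem_univ, true_and]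
    constructor
    · intro hs
      exact ⟨ε, by rwa [← hmem.1 hε], hε⟩
    · rintro ⟨ε', hs, hε'⟩
      rwa [hmem.1 hε']
  rw [singularityProb, hcongr, hU, one_div, inv_pow, ← div_eq_mul_inv, singularCount]

/-! ### Probability bounds for a single divisor -/

/-- The largest probability of a value of a sum of `k` independent signs. -/
noncomputable def signSumConcentration (k : ℕ) : ℝ := k.choose (k / 2) / 2 ^ k

theorem signSumConcentration_nonneg (k : ℕ) : 0 ≤ signSumConcentration k := by
  unfold signSumConcentration; positivity

theorem signSumConcentration_sq_le {k : ℕ} (hk : 0 < k) :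
    signSumConcentration k ^ 2 ≤ 1 / k := by
  have h : ((k.choose (k / 2) : ℝ)) ^ 2 * k ≤ 4 ^ k := by
    exact_mod_cast Nat.choose_half_sq_mul_le k
  have hk' : (0 : ℝ) < k := by exact_mod_cast hk
  rw [signSumConcentration, div_pow, ← pow_mul, mul_comm k 2, pow_mul,
    div_le_div_iff₀ (by positivity) hk']
  norm_num
  exact h

theorem signSumConcentration_le_half {k : ℕ} (hk : 0 < k) : signSumConcentration k ≤ 1 / 2 := by
  obtain ⟨k, rfl⟩ := Nat.exists_eq_succ_of_ne_zero hk.ne'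
  have h : (((k + 1).choose ((k + 1) / 2) : ℝ)) ≤ 2 ^ k := by
    exact_mod_cast Nat.choose_succ_le_two_pow k _
  rw [signSumConcentration, div_le_div_iff₀ (by positivity) (by norm_num), Nat.succ_eq_add_one,
    pow_succ]
  linarith

theorem le_signSumConcentration_sq {n : ℕ} (hn : 0 < n) (he : Even n) :
    1 / (2 * n) ≤ signSumConcentration n ^ 2 := by
  obtain ⟨j, rfl⟩ := he
  obtain ⟨j, rfl⟩ := Nat.exists_eq_succ_of_ne_zero (show j ≠ 0 by omega)
  have h : (16 : ℝ) ^ (j + 1) ≤ (Nat.centralBinom (j + 1) : ℝ) ^ 2 * (4 * (j + 1)) := by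
    exact_mod_cast Nat.le_centralBinom_sq_mul j
  rw [Nat.centralBinom] at h
  rw [signSumConcentration, ← two_mul, Nat.mul_div_cancel_left _ (by norm_num), div_pow, ← pow_mul,
    div_le_div_iff₀ (by positivity) (by positivity), mul_comm _ 2, ← mul_assoc, pow_mul]
  norm_num at h ⊢
  linarith

theorem vanishingCount_div_le {n m : ℕ} (hn : n ≠ 0) (hm : m ∣ n) :
    (vanishingCount n (unityRoot m) : ℝ) / 2 ^ n ≤ signSumConcentration (n / m) ^ m.totient := by
  have hm0 := Nat.pos_of_dvd_of_pos hm (Nat.pos_of_ne_zero hn)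
  obtain ⟨k, rfl⟩ := hm
  rw [Nat.mul_div_cancel_left _ hm0, mul_comm m k]
  have h : (vanishingCount (k * m) (unityRoot m) : ℝ) ≤
      (k.choose (k / 2) : ℝ) ^ m.totient * (2 ^ k) ^ (m - m.totient) := by
    exact_mod_cast vanishingCount_mul_le hm0 (isPrimitiveRoot_unityRoot hm0.ne')
  have h2 : (2 : ℝ) ^ (k * m) = (2 ^ k) ^ m.totient * (2 ^ k) ^ (m - m.totient) := by
    rw [← pow_add, Nat.add_sub_cancel' (Nat.totient_le m), pow_mul]
  rw [signSumConcentration, div_pow, h2, div_le_div_iff₀ (by positivity) (by positivity)]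
  calc _ ≤ ((k.choose (k / 2) : ℝ) ^ m.totient * (2 ^ k) ^ (m - m.totient)) *
        (2 ^ k) ^ m.totient := by gcongr
    _ = _ := by ring

theorem vanishingCount_div_le_two_zpow {n m : ℕ} (hn : n ≠ 0) (hm : m ∣ n) :
    (vanishingCount n (unityRoot m) : ℝ) / 2 ^ n ≤ (2 : ℝ) ^ (-(m.totient : ℤ)) := by
  have hk : 0 < n / m := Nat.div_pos (Nat.le_of_dvd (Nat.pos_of_ne_zero hn) hm)
    (Nat.pos_of_dvd_of_pos hm (Nat.pos_of_ne_zero hn))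
  refine (vanishingCount_div_le hn hm).trans ?_
  calc _ ≤ (1 / 2 : ℝ) ^ m.totient :=
        pow_le_pow_left₀ (signSumConcentration_nonneg _) (signSumConcentration_le_half hk) _
    _ = _ := by rw [zpow_neg, zpow_natCast, one_div, inv_pow]

/-- Two of the φ(m) factors give 1/k = m/n. Each of the others is at most 1/2, and together they
absorb `m`, because m ≤ 4·2^φ(m) = 16·2^(φ(m)-2). -/
theorem vanishingCount_div_le_of_three_le {n m : ℕ} (hn : n ≠ 0) (hm : m ∣ n) (h3 : 3 ≤ m) :
    (vanishingCount n (unityRoot m) : ℝ) / 2 ^ n ≤ 16 / n := by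
  have hm0 : 0 < m := by omega
  have hφ : 2 ≤ m.totient := by
    have := Nat.totient_even (show 2 < m by omega)
    have := Nat.totient_pos.2 hm0
    rcases ‹Even _› with ⟨t, ht⟩
    omega
  have hk : 0 < n / m := Nat.div_pos (Nat.le_of_dvd (Nat.pos_of_ne_zero hn) hm) hm0
  refine (vanishingCount_div_le hn hm).trans ?_
  obtain ⟨t, ht⟩ := Nat.exists_eq_add_of_le hφ
  have hle : (m : ℝ) ≤ 4 * 2 ^ m.totient := by exact_mod_cast Nat.le_mul_two_pow_totient m
  have hn' : (0 : ℝ) < n := by exact_mod_cast Nat.pos_of_ne_zero hn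
  have hm' : (0 : ℝ) < m := by exact_mod_cast hm0
  calc signSumConcentration (n / m) ^ m.totient
      = signSumConcentration (n / m) ^ 2 * signSumConcentration (n / m) ^ t := by
        rw [ht, pow_add]
    _ ≤ 1 / ((n / m : ℕ) : ℝ) * (1 / 2) ^ t := by
        gcongr
        · exact pow_nonneg (signSumConcentration_nonneg _) t
        · exact signSumConcentration_sq_le hk
        · exact signSumConcentration_nonneg _
        · exact signSumConcentration_le_half hk
    _ = m / (n * 2 ^ t) := by
        rw [Nat.cast_div hm hm'.ne', one_div_pow]
        field_simp
    _ ≤ 16 / n := by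
        rw [ht, pow_add] at hle
        rw [div_le_div_iff₀ (by positivity) hn']
        nlinarith

theorem vanishingCount_div_le_of_le_two {n m : ℕ} (hn : n ≠ 0) (hm : m ∣ n) (h2 : m ≤ 2) :
    (vanishingCount n (unityRoot m) : ℝ) / 2 ^ n ≤ 2 / √n := by
  have hm0 := Nat.pos_of_dvd_of_pos hm (Nat.pos_of_ne_zero hn)
  have hφ : m.totient = 1 := by interval_cases m <;> simp
  have hk : 0 < n / m := Nat.div_pos (Nat.le_of_dvd (Nat.pos_of_ne_zero hn) hm) hm0
  refine (vanishingCount_div_le hn hm).trans ?_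
  have hn' : (0 : ℝ) < n := by exact_mod_cast Nat.pos_of_ne_zero hn
  have hm' : (0 : ℝ) < m := by exact_mod_cast hm0
  have hm2 : (m : ℝ) ≤ 2 := by exact_mod_cast h2
  rw [hφ, pow_one]
  refine abs_le_of_sq_le_sq' ?_ (by positivity) |>.2
  refine (signSumConcentration_sq_le hk).trans ?_
  rw [div_pow, Real.sq_sqrt hn'.le, Nat.cast_div hm hm'.ne', one_div_div]
  gcongr
  linarith

theorem IsIIDSigns.singularityProb_le_sum {n : ℕ} (hn : n ≠ 0) {Ω : Type*} [MeasurableSpace Ω]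
    {μ : MeasureTheory.Measure Ω} [MeasureTheory.IsProbabilityMeasure μ] {X : Fin n → Ω → ℂ}
    (h : IsIIDSigns μ X) :
    singularityProb μ X ≤ ∑ m ∈ n.divisors, (vanishingCount n (unityRoot m) : ℝ) / 2 ^ n := by
  rw [h.singularityProb_eq, ← Finset.sum_div]
  gcongr
  exact_mod_cast singularCount_le_sum hn

/-! ### Assembling the three cases -/

theorem theorem3 :
    ∃ c₁ c₂ c₃ : ℝ, 0 < c₁ ∧ 0 < c₂ ∧ 0 < c₃ ∧
      ∀ (n : ℕ) (Ω : Type*) [MeasurableSpace Ω] (μ : MeasureTheory.Measure Ω)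
        [MeasureTheory.IsProbabilityMeasure μ] (X : Fin n → Ω → ℂ), IsIIDSigns μ X →
        (0 < n → Even n →
          c₁ / Real.sqrt n ≤ singularityProb μ X ∧
          singularityProb μ X ≤ c₂ / Real.sqrt n) ∧
        (3 ≤ n → Odd n →
          singularityProb μ X ≤
            min (c₃ * ((n.divisors.card : ℝ) / n))
              (∑ m ∈ (Finset.Ioc 1 n).filter (fun m => m ∣ n),
                (2 : ℝ) ^ (-(Nat.totient m : ℤ)))) ∧
        (3 ≤ n → n.Prime →
          singularityProb μ X = (2 : ℝ) ^ (-(n : ℤ) + 1)) := by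
  -- The bound ρ(n) ≥ 1/√(2n) for even n leaves room for 1/2. The 36 is 4 + 32: at most two divisors
  -- m ≤ 2 at 2/√n each, and at most 2√n others at 16/n each.
  refine ⟨1 / 2, 36, 16, by norm_num, by norm_num, by norm_num, ?_⟩
  intro n Ω _ μ _ X hX
  refine ⟨fun hn he => ⟨?_, ?_⟩, fun h3 ho => ?_, fun h3 hp => ?_⟩
  · have hn' : (0 : ℝ) < n := by exact_mod_cast hn
    calc 1 / 2 / √n ≤ signSumConcentration n := by
          refine (abs_le_of_sq_le_sq' ?_ (signSumConcentration_nonneg n)).2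
          refine le_trans ?_ (le_signSumConcentration_sq hn he)
          rw [div_pow, Real.sq_sqrt hn'.le, div_le_div_iff₀ hn' (by positivity)]
          linarith
      _ ≤ singularityProb μ X := by
          rw [hX.singularityProb_eq, signSumConcentration]
          gcongr
          exact choose_half_le_singularCount hn.ne' he
  · have hn' : (0 : ℝ) < n := by exact_mod_cast hn
    have hs : 0 < √(n : ℝ) := Real.sqrt_pos.2 hn'
    refine (hX.singularityProb_le_sum hn.ne').trans ?_
    rw [← Finset.sum_filter_add_sum_filter_not _ (fun m => m ≤ 2)]
    have h1 : ∑ m ∈ n.divisors with m ≤ 2, (vanishingCount n (unityRoot m) : ℝ) / 2 ^ n ≤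
        4 / √n := by
      have hc : (n.divisors.filter (· ≤ 2)).card ≤ 2 := by
        refine (Finset.card_le_card (t := {1, 2}) fun m hm => ?_)
        have h1 := Finset.mem_filter.1 hm
        have := Nat.pos_of_mem_divisors h1.1
        simp only [Finset.mem_insert, Finset.mem_singleton]
        omega
      have hc' : ((n.divisors.filter (· ≤ 2)).card : ℝ) ≤ 2 := by exact_mod_cast hc
      refine (Finset.sum_le_card_nsmul _ _ (2 / √n) fun m hm => ?_).trans ?_
      · have hm := Finset.mem_filter.1 hm
        exact vanishingCount_div_le_of_le_two hn.ne' (Nat.dvd_of_mem_divisors hm.1) hm.2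
      · rw [nsmul_eq_mul, show (4 : ℝ) / √n = 2 * (2 / √n) by ring]
        gcongr
    have h2 : ∑ m ∈ n.divisors with ¬ m ≤ 2, (vanishingCount n (unityRoot m) : ℝ) / 2 ^ n ≤
        32 / √n := by
      have hc : ((n.divisors.filter (¬ · ≤ 2)).card : ℝ) ≤ 2 * √n := by
        calc ((n.divisors.filter (¬ · ≤ 2)).card : ℝ) ≤ (2 * Nat.sqrt n : ℕ) := by
              exact_mod_cast (Finset.card_filter_le _ _).trans (Nat.card_divisors_le_two_mul_sqrt n)
          _ ≤ 2 * √n := by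
              push_cast
              gcongr
              exact Real.nat_sqrt_le_real_sqrt
      refine (Finset.sum_le_card_nsmul _ _ (16 / (n : ℝ)) fun m hm => ?_).trans ?_
      · have hm := Finset.mem_filter.1 hm
        exact vanishingCount_div_le_of_three_le hn.ne' (Nat.dvd_of_mem_divisors hm.1) (by omega)
      · rw [nsmul_eq_mul]
        calc _ ≤ 2 * √n * (16 / n) := by gcongr
          _ = 32 / √n := by
            conv_lhs => rw [← Real.mul_self_sqrt hn'.le]
            rw [Real.sqrt_mul_self hs.le]
            field_simp
            norm_num
    calc _ ≤ 4 / √n + 32 / √n := add_le_add h1 h2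
      _ = 36 / √n := by ring
  · have hn : n ≠ 0 := by omega
    have hsum : singularityProb μ X ≤
        ∑ m ∈ n.divisors.erase 1, (vanishingCount n (unityRoot m) : ℝ) / 2 ^ n := by
      -- A sum of an odd number of signs is odd, so the root 1 contributes nothing.
      rw [Finset.sum_erase _ (by rw [vanishingCount_one_of_odd ho]; simp)]
      exact hX.singularityProb_le_sum hn
    refine le_min (hsum.trans ?_) (hsum.trans ?_)
    · refine (Finset.sum_le_card_nsmul _ _ (16 / (n : ℝ)) fun m hm => ?_).trans ?_
      · obtain ⟨hm1, hm⟩ := Finset.mem_erase.1 hm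
        have hdvd := Nat.dvd_of_mem_divisors hm
        have hm0 := Nat.pos_of_mem_divisors hm
        have hm2 : m ≠ 2 := by
          rintro rfl
          exact Nat.not_even_iff_odd.2 ho (even_iff_two_dvd.2 hdvd)
        exact vanishingCount_div_le_of_three_le hn hdvd (by omega)
      · rw [nsmul_eq_mul, mul_comm (16 : ℝ), div_mul_eq_mul_div, ← mul_div_assoc]
        gcongr
        exact Finset.erase_subset _ _
    · have : n.divisors.erase 1 = (Finset.Ioc 1 n).filter (fun m => m ∣ n) := by
        ext m
        simp only [Finset.mem_erase, Nat.mem_divisors, Finset.mem_filter, Finset.mem_Ioc]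
        constructor
        · rintro ⟨h1, hd, -⟩
          have := Nat.pos_of_dvd_of_pos hd (by omega)
          exact ⟨⟨by omega, Nat.le_of_dvd (by omega) hd⟩, hd⟩
        · rintro ⟨⟨h1, -⟩, hd⟩
          exact ⟨by omega, hd, hn⟩
      rw [this]
      refine Finset.sum_le_sum fun m hm => ?_
      exact vanishingCount_div_le_two_zpow hn (Finset.mem_filter.1 hm).2
  · rw [hX.singularityProb_eq, singularCount_prime hp h3, zpow_add₀ two_ne_zero, zpow_neg,
      zpow_natCast, zpow_one, div_eq_mul_inv, mul_comm]
    norm_num
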